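/- Let $X_1,X_2,\dots$ be real observations, $S_n=\sum_{i\le n}X_i$, $V_n=\sum_{i\le n}X_i^2$, $\bar X_n=S_n/n$. Let $\mathcal N$ be the class of all normal distributions with positive variance and $\mathcal N_{\mu=0}\subset\mathcal N$ those with mean $0$. For $n\ge1$ let $\mathcal F_n^*$ be the $\sigma$-algebra generated by all $f(X_1,\dots,X_n)$ with $f:\mathbb R^n\to\mathbb R$ measurable and $f(\lambda x)=f(x)$ for all $\lambda>0$, $x\in\mathbb R^n$. A nonnegative $\{\mathcal F_n^*\}_{n\ge1}$-adapted process $\{M_n\}_{n\ge1}$ is called an e-process for a class $\mathcal P$ on $\{\mathcal F_n^*\}$ if $\mathbb E_P[M_\tau]\le1$ for every $P\in\mathcal P$ and every $\{\mathcal F_n^*\}$-stopping time $\tau\in\{1,2,\dots,\infty\}$, where $\mathbb E_P$ is the expectation when $X_1,X_2,\dots$ are i.i.d. with distribution $P$, and $M_\infty=\limsup_n M_n$. **Theorem (scale invariant semi-one-sided t-test e-process).** Let $c>0$ and $$G_n^{(c-)}=2\sqrt{\tfrac{c^2}{n+c^2}}\left(\Big(1-\tfrac{S_n^2}{(n+c^2)V_n}\Big)^{-n/2}-\Big(1-\tfrac{(S_n\wedge0)^2}{(n+c^2)V_n}\Big)^{-n/2}\right),\qquad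 n\ge1$$ (with $0/0=0$, so that $G_n^{(c-)}=0$ when $V_n=0$). 1. $G_n^{(c-)}=2G_n^{(c)}-2G_n^{(c)}|_{S_n\leftarrow S_n\wedge0}$, where $G_n^{(c)}=\sqrt{\tfrac{c^2}{n+c^2}}\Big(\tfrac{(n+c^2)V_n}{(n+c^2)V_n-S_n^2}\Big)^{n/2}$ and, in the second term, $S_n$ is replaced by $S_n\wedge0$ in this formula (same convention if $V_n=0$). 2. $\{G_n^{(c-)}\}_{n\ge1}$ is an e-process for $\mathcal N_{\mu=0}$ on the scale invariant filtration $\{\mathcal F_n^*\}_{n\ge1}$. 3. For every $n\ge1$ and every sample with $V_n\neq0$ (hence almost surely under every $P\in\mathcal N$), $\theta\mapsto h_n(\theta;0)$ is $\pi^+$-integrable and $$G_n^{(c-)}\le 2\int h_n(\theta;0)\,\pi^+(d\theta),$$ where $\pi^+(d\theta)=\mathbf 1_{\theta\ge0}\frac{c}{\sqrt{2\pi}}e^{-c^2\theta^2/2}\,d\theta$ is the half-Gaussian measure (total mass $1/2$) and $$h_n(\theta;\theta_0)=\frac{\int_0^\infty\prod_{i=1}^n p_{\tau\theta,\tau^2}(X_i)\,\frac{d\tau}{\tau}}{\int_0^\infty\prod_{i=1}^n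 p_{\tau\theta_0,\tau^2}(X_i)\,\frac{d\tau}{\tau}}$$ is the scale invariant likelihood ratio, $p_{m,v}$ being the density of the normal distribution with mean $m$ and variance $v$. 4. For $\alpha\in(0,1)$ let $\mathrm{CI}_n$ be the set of all $m\in\mathbb R$ such that $G_n^{(c-)}$, computed from the shifted data $X_1-m,\dots,X_n-m$, is at most $1/\alpha$. Then $\{\mathrm{CI}_n\}_{n\ge1}$ is a $(1-\alpha)$-confidence sequence for the mean over $\mathcal N$: for every $P\in\mathcal N$ with mean $\mu$, if $X_1,X_2,\dots$ are i.i.d. with distribution $P$, the probability that $\mu\in\mathrm{CI}_n$ for all $n\ge1$ is at least $1-\alpha$. It is one-sided: for every $n$ and every sample, $\mathrm{CI}_n=\{m\in\mathbb R: m\ge L_n\}$ for some $L_n\in[-\infty,\bar X_n]$. -/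

import Mathlib

open MeasureTheory ProbabilityTheory Filter Set
open scoped NNReal ENNReal

noncomputable section

namespace TTest

/-- The partial sum `S_n` of a data sequence; `x i` is the `(i + 1)`-st observation. -/
def partialSum (n : ℕ) (x : ℕ → ℝ) : ℝ := ∑ i ∈ Finset.range n, x i

/-- The partial sum of squares `V_n`. -/
def sumSq (n : ℕ) (x : ℕ → ℝ) : ℝ := ∑ i ∈ Finset.range n, x i ^ 2

/-- The two-sided Gaussian mixture statistic `G_n^{(c)}`, as a function of the values `s` of `S_n`
and `v` of `V_n`. -/
def twoSidedG (c : ℝ) (n : ℕ) (s v : ℝ) : ℝ :=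
  √(c ^ 2 / (n + c ^ 2)) *
    (((n + c ^ 2) * v) / ((n + c ^ 2) * v - s ^ 2)) ^ ((n : ℝ) / 2)

/-- The semi-one-sided statistic `G_n^{(c-)}` of the data `x`. -/
def semiOneSidedG (c : ℝ) (n : ℕ) (x : ℕ → ℝ) : ℝ :=
  2 * √(c ^ 2 / (n + c ^ 2)) *
    ((1 - partialSum n x ^ 2 / ((n + c ^ 2) * sumSq n x)) ^ (-(n : ℝ) / 2)
      - (1 - (min (partialSum n x) 0) ^ 2 / ((n + c ^ 2) * sumSq n x)) ^ (-(n : ℝ) / 2))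

/-- All normal distributions with positive variance. -/
def normals : Set (Measure ℝ) := {P | ∃ (m : ℝ) (v : ℝ≥0), v ≠ 0 ∧ P = gaussianReal m v}

/-- All normal distributions with mean `m` and positive variance. -/
def normalsWithMean (m : ℝ) : Set (Measure ℝ) := {P | ∃ v : ℝ≥0, v ≠ 0 ∧ P = gaussianReal m v}

/-- A measurable function of `n` real variables that is invariant under positive scaling. -/
def IsScaleInvariant {n : ℕ} (f : (Fin n → ℝ) → ℝ) : Prop :=
  Measurable f ∧ ∀ (x : Fin n → ℝ) (r : ℝ), 0 < r → f (fun i => r * x i) = f x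

/-- The σ-algebra generated by all `f (X_1, …, X_n)` with `f` scale invariant. -/
abbrev scaleInvariantSigma {Ω : Type*} (X : ℕ → Ω → ℝ) (n : ℕ) : MeasurableSpace Ω :=
  ⨆ f : {f : (Fin n → ℝ) → ℝ // IsScaleInvariant f},
    MeasurableSpace.comap (fun ω => f.1 (fun i => X i ω)) inferInstance

/-- The scale invariant filtration of the data, indexed by `n ≥ 1`. -/
def scaleInvariantFiltration {Ω : Type*} [mΩ : MeasurableSpace Ω] (X : ℕ → Ω → ℝ)
    (hX : ∀ i, Measurable (X i)) : Filtration ℕ+ mΩ where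
  seq n := scaleInvariantSigma X n
  mono' := by
    intro n m hnm
    have h : (n : ℕ) ≤ m := hnm
    refine iSup_le fun f => ?_
    refine le_iSup_of_le
      ⟨fun x => f.1 (fun i => x (Fin.castLE h i)), ?_, ?_⟩ le_rfl
    · exact f.2.1.comp (measurable_pi_lambda _ fun i => measurable_pi_apply _)
    · intro x r hr
      exact f.2.2 (fun i => x (Fin.castLE h i)) r hr
  le' := by
    intro n
    refine iSup_le fun f => ?_
    exact (f.2.1.comp (measurable_pi_lambda _ fun i => hX i)).comap_le

/-- Under the probability measure `Pr`, the observations are i.i.d. with distribution `P`. -/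
def IsIID {Ω : Type*} [MeasurableSpace Ω] (X : ℕ → Ω → ℝ) (P : Measure ℝ) (Pr : Measure Ω) :
    Prop :=
  iIndepFun X Pr ∧ ∀ i, Pr.map (X i) = P

/-- The value `M_τ` of a nonnegative process at a random time `τ ∈ {1, 2, …, ∞}`, with
`M_∞ = limsup M_n`. -/
def valueAt {Ω : Type*} (M : ℕ+ → Ω → ℝ) (τ : Ω → WithTop ℕ+) (ω : Ω) : ℝ≥0∞ :=
  WithTop.recTopCoe (C := fun _ => ℝ≥0∞)
    (limsup (fun n : ℕ+ => ENNReal.ofReal (M n ω)) atTop)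
    (fun n : ℕ+ => ENNReal.ofReal (M n ω)) (τ ω)

/-- `M` is an e-process for the class `Ps` on the filtration `𝒢`: it is nonnegative, adapted, and
for every (possibly infinite) stopping time `τ` of `𝒢` its stopped value has expectation at most
`1` whenever the data are i.i.d. with a distribution in `Ps`. -/
structure IsEProcess {Ω : Type*} [mΩ : MeasurableSpace Ω] (X : ℕ → Ω → ℝ)
    (Ps : Set (Measure ℝ)) (𝒢 : Filtration ℕ+ mΩ) (M : ℕ+ → Ω → ℝ) : Prop where
  nonneg : ∀ n ω, 0 ≤ M n ω
  adapted : ∀ n, Measurable[𝒢 n] (M n)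
  expectation_le_one : ∀ P ∈ Ps, ∀ Pr : Measure Ω, IsProbabilityMeasure Pr → IsIID X P Pr →
    ∀ τ : Ω → WithTop ℕ+, IsStoppingTime 𝒢 τ → ∫⁻ ω, valueAt M τ ω ∂Pr ≤ 1

/-- The random sets `CI n` form a `(1 - α)`-confidence sequence over the class `Ps` for the
parameter `ϑ`. -/
def IsConfidenceSequence {Ω : Type*} [MeasurableSpace Ω] (X : ℕ → Ω → ℝ)
    (Ps : Set (Measure ℝ)) (ϑ : Measure ℝ → ℝ) (α : ℝ) (CI : ℕ+ → Ω → Set ℝ) : Prop :=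
  ∀ P ∈ Ps, ∀ Pr : Measure Ω, IsProbabilityMeasure Pr → IsIID X P Pr →
    ENNReal.ofReal (1 - α) ≤ Pr {ω | ∀ n, ϑ P ∈ CI n ω}

/-- The mixture over the scale `τ`, with respect to `dτ / τ`, of the joint density at
`(x_1, …, x_n)` of `n` i.i.d. observations from `N(τ θ, τ²)`. -/
def scaleMixture (θ : ℝ) (n : ℕ) (x : ℕ → ℝ) : ℝ :=
  ∫ τ in Ioi (0 : ℝ),
    (∏ i ∈ Finset.range n, gaussianPDFReal (τ * θ) (Real.toNNReal (τ ^ 2)) (x i)) / τ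

/-- The scale invariant likelihood ratio `h_n(θ; θ₀)` between the standardized means
`θ` and `θ₀`. -/
def scaleInvariantLR (θ θ₀ : ℝ) (n : ℕ) (x : ℕ → ℝ) : ℝ :=
  scaleMixture θ n x / scaleMixture θ₀ n x

/-- The half-Gaussian prior: the restriction of `N(0, c⁻²)` to `[0, ∞)`, of total mass `1/2`. -/
def halfGaussian (c : ℝ) : Measure ℝ :=
  (gaussianReal 0 (Real.toNNReal (c ^ 2)⁻¹)).restrict (Ici 0)

/-- All `m` for which the statistic of the shifted data `X_i - m` is at most `1 / α`. -/
def semiOneSidedCI {Ω : Type*} (X : ℕ → Ω → ℝ) (c α : ℝ) (n : ℕ+) (ω : Ω) : Set ℝ :=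
  {m | semiOneSidedG c n (fun i => X i ω - m) ≤ 1 / α}

end TTest

end

/-! Write `τ = exp (-t)`, so that `dτ/τ` becomes Lebesgue measure in `t` and the normal likelihood
depends on the data only through `S_n` and `V_n`. Scaling the data by `exp a` translates `t` by `a`,
up to a factor free of `θ`; the ratio `h_n(θ; 0)` is therefore scale invariant. The substitution `x
↦ exp (-t) • x` moreover shows that on scale invariant events `h_n(θ; 0)` is the density of `N(θ,
1)^n` with respect to `N(0, σ²)^n`, whatever `σ` is (`setLIntegral_ratio`).

Twice the half-Gaussian mixture of these ratios, `mixtureLR`, is thus the density of one fixed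
mixture of i.i.d. laws, hence a nonnegative martingale of mean one. It converges almost surely, so
Fatou's lemma handles every stopping time and every dominated process (`lintegral_valueAt_le_one`).

The full Gaussian mixture is explicit by completing the square, and gives `G_n^{(c)}`. If `S_n ≥ 0`,
its part over `θ < 0` is at most the full mixture with `S_n` replaced by `0`; subtracting leaves a
lower bound for the half-Gaussian part, which is half of `G_n^{(c-)}`
(`ofReal_mul_lscaleMixture_le`).

Coverage is Ville's inequality for the data shifted by the true mean. For the shape of the
intervals, the statistic of the data shifted by `m` is nondecreasing in `d = X̄_n - m` and has
closed sublevel sets. -/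

namespace TTest

/-! ### Optional stopping, including infinite stopping times -/

section Stopping

variable {Ω : Type*}

/-- The process `E` stopped at `τ`, reindexed by the natural numbers. -/
noncomputable def stopped (E : ℕ+ → Ω → ℝ≥0∞) (τ : Ω → WithTop ℕ+) : ℕ → Ω → ℝ≥0∞
  | 0 => E (Nat.succPNat 0)
  | k + 1 => fun ω =>
      open Classical in
      if τ ω ≤ (Nat.succPNat k : ℕ+) then stopped E τ k ω else E (Nat.succPNat (k + 1)) ω

/-- Index `k` stands for time `k + 1`, so `stopped E τ k` is `E` at time `min τ (k + 1)`. -/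
lemma stopped_of_gt (E : ℕ+ → Ω → ℝ≥0∞) (τ : Ω → WithTop ℕ+) (ω : Ω) (k : ℕ)
    (h : ((Nat.succPNat k : ℕ+) : WithTop ℕ+) ≤ τ ω) :
    stopped E τ k ω = E (Nat.succPNat k) ω := by
  cases k with
  | zero => rfl
  | succ k =>
    have h1 : ((Nat.succPNat k : ℕ+) : WithTop ℕ+) < (Nat.succPNat (k + 1) : ℕ+) :=
      WithTop.coe_lt_coe.2 (Nat.succPNat_lt_succPNat.2 (Nat.lt_succ_self k))
    simp [stopped, not_le.2 (h1.trans_le h)]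

lemma stopped_of_eq (E : ℕ+ → Ω → ℝ≥0∞) (τ : Ω → WithTop ℕ+) (ω : Ω) (j : ℕ)
    (h : τ ω = (Nat.succPNat j : ℕ+)) (k : ℕ) (hk : j ≤ k) :
    stopped E τ k ω = E (Nat.succPNat j) ω := by
  induction k, hk using Nat.le_induction with
  | base => exact stopped_of_gt E τ ω j h.ge
  | succ k hk ih =>
    have : τ ω ≤ (Nat.succPNat k : ℕ+) := by
      rw [h]; exact WithTop.coe_le_coe.2 (Nat.succPNat_le_succPNat.2 hk)
    simp only [stopped, if_pos this, ih]

variable [mΩ : MeasurableSpace Ω]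

lemma measurable_stopped {𝒢 : Filtration ℕ+ mΩ} {E : ℕ+ → Ω → ℝ≥0∞}
    (hE : ∀ n, Measurable[𝒢 n] (E n)) {τ : Ω → WithTop ℕ+} (hτ : IsStoppingTime 𝒢 τ) (k : ℕ) :
    Measurable (stopped E τ k) := by
  induction k with
  | zero => exact (hE _).mono (𝒢.le _) le_rfl
  | succ k ih =>
    exact Measurable.ite (𝒢.le _ _ (hτ (Nat.succPNat k))) ih ((hE _).mono (𝒢.le _) le_rfl)

/-- One step changes nothing on `{τ ≤ k + 1}`, where the process is frozen; the complement belongs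
to the σ-algebra at time `k + 1`, so the martingale property applies there. -/
lemma lintegral_stopped {𝒢 : Filtration ℕ+ mΩ} {E : ℕ+ → Ω → ℝ≥0∞} {Pr : Measure Ω}
    (hmart : ∀ k : ℕ, ∀ A, MeasurableSet[𝒢 (Nat.succPNat k)] A →
      ∫⁻ ω in A, E (Nat.succPNat (k + 1)) ω ∂Pr = ∫⁻ ω in A, E (Nat.succPNat k) ω ∂Pr)
    {τ : Ω → WithTop ℕ+} (hτ : IsStoppingTime 𝒢 τ) (k : ℕ) :
    ∫⁻ ω, stopped E τ k ω ∂Pr = ∫⁻ ω, E (Nat.succPNat 0) ω ∂Pr := by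
  induction k with
  | zero => rfl
  | succ k ih =>
    set A := {ω | τ ω ≤ (Nat.succPNat k : ℕ+)} with hA
    have hAm : MeasurableSet[𝒢 (Nat.succPNat k)] A := hτ _
    have hAm' : MeasurableSet A := 𝒢.le _ _ hAm
    rw [← ih, ← lintegral_add_compl (stopped E τ (k + 1)) hAm',
      ← lintegral_add_compl (stopped E τ k) hAm']
    congr 1
    · refine setLIntegral_congr_fun hAm' fun ω hω => ?_
      have : τ ω ≤ (Nat.succPNat k : ℕ+) := hω
      simp [stopped, this]
    · calc ∫⁻ ω in Aᶜ, stopped E τ (k + 1) ω ∂Pr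
          = ∫⁻ ω in Aᶜ, E (Nat.succPNat (k + 1)) ω ∂Pr := by
            refine setLIntegral_congr_fun hAm'.compl fun ω hω => ?_
            have : ¬ τ ω ≤ (Nat.succPNat k : ℕ+) := hω
            simp [stopped, this]
        _ = ∫⁻ ω in Aᶜ, E (Nat.succPNat k) ω ∂Pr := hmart k _ hAm.compl
        _ = _ := by
            refine setLIntegral_congr_fun hAm'.compl fun ω hω => ?_
            have : ¬ τ ω ≤ (Nat.succPNat k : ℕ+) := hω
            exact (stopped_of_gt E τ ω k (not_le.1 this).le).symm

/-- A nonnegative process with the martingale property for set integrals converges almost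
surely. -/
lemma ae_exists_tendsto {𝒢 : Filtration ℕ+ mΩ} {E : ℕ+ → Ω → ℝ≥0∞} {Pr : Measure Ω}
    [IsProbabilityMeasure Pr]
    (hE : ∀ n, Measurable[𝒢 n] (E n))
    (hmart : ∀ k : ℕ, ∀ A, MeasurableSet[𝒢 (Nat.succPNat k)] A →
      ∫⁻ ω in A, E (Nat.succPNat (k + 1)) ω ∂Pr = ∫⁻ ω in A, E (Nat.succPNat k) ω ∂Pr)
    (hone : ∫⁻ ω, E (Nat.succPNat 0) ω ∂Pr ≤ 1) :
    ∀ᵐ ω ∂Pr, ∃ l, Tendsto (fun k => E (Nat.succPNat k) ω) atTop (nhds l) := by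
  have hE' : ∀ n, Measurable (E n) := fun n => (hE n).mono (𝒢.le _) le_rfl
  have hle : ∀ k : ℕ, ∫⁻ ω, E (Nat.succPNat k) ω ∂Pr ≤ 1 := by
    intro k
    induction k with
    | zero => exact hone
    | succ k ih => simpa using (hmart k univ MeasurableSet.univ).trans_le (by simpa using ih)
  have hfin : ∀ k, ∀ᵐ ω ∂Pr, E (Nat.succPNat k) ω < ∞ := fun k =>
    ae_lt_top (hE' _) ((hle k).trans_lt ENNReal.one_lt_top).ne
  -- Doob's convergence theorem is applied to the real-valued versions, indexed by `ℕ`; they lose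
  -- only null sets where `E` is infinite.
  let ℱ : Filtration ℕ mΩ :=
    { seq := fun k => 𝒢 (Nat.succPNat k)
      mono' := fun i j hij => 𝒢.mono (Nat.succPNat_le_succPNat.2 hij)
      le' := fun k => 𝒢.le _ }
  let f : ℕ → Ω → ℝ := fun k ω => (E (Nat.succPNat k) ω).toReal
  have hint : ∀ k, Integrable (f k) Pr := fun k =>
    integrable_toReal_of_lintegral_ne_top (hE' _).aemeasurable
      ((hle k).trans_lt ENNReal.one_lt_top).ne
  have hset : ∀ k (s : Set Ω), ∫ ω in s, f k ω ∂Pr = (∫⁻ ω in s, E (Nat.succPNat k) ω ∂Pr).toReal :=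
    fun k s => integral_toReal (hE' _).aemeasurable (ae_restrict_of_ae (hfin k))
  have hsub : Submartingale f ℱ Pr := by
    refine submartingale_of_setIntegral_le_succ ?_ hint ?_
    · intro k
      exact (Measurable.ennreal_toReal (hE (Nat.succPNat k))).stronglyMeasurable
    · intro k s hs
      rw [hset, hset, hmart k s hs]
  have hconv := hsub.ae_tendsto_limitProcess (R := 1) (fun k => by
    rw [eLpNorm_one_eq_lintegral_enorm]
    refine le_trans (lintegral_mono fun ω => ?_) (hle k)
    rw [Real.enorm_of_nonneg ENNReal.toReal_nonneg]
    exact ENNReal.ofReal_toReal_le)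
  filter_upwards [hconv, ae_all_iff.2 hfin] with ω h1 h2
  refine ⟨_, ((ENNReal.continuous_ofReal.tendsto _).comp h1).congr fun k => ?_⟩
  exact ENNReal.ofReal_toReal (h2 k).ne

/-- A process dominated by a nonnegative process that has the martingale property and starts with
expectation at most one has expectation at most one at every stopping time. -/
theorem lintegral_valueAt_le_one {𝒢 : Filtration ℕ+ mΩ} {E : ℕ+ → Ω → ℝ≥0∞} {Pr : Measure Ω}
    [IsProbabilityMeasure Pr]
    (hE : ∀ n, Measurable[𝒢 n] (E n))
    (hmart : ∀ n m, n ≤ m → ∀ A, MeasurableSet[𝒢 n] A →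
      ∫⁻ ω in A, E m ω ∂Pr = ∫⁻ ω in A, E n ω ∂Pr)
    (hone : ∀ n, ∫⁻ ω, E n ω ∂Pr ≤ 1)
    {M : ℕ+ → Ω → ℝ} (hM : ∀ n ω, ENNReal.ofReal (M n ω) ≤ E n ω)
    {τ : Ω → WithTop ℕ+} (hτ : IsStoppingTime 𝒢 τ) :
    ∫⁻ ω, valueAt M τ ω ∂Pr ≤ 1 := by
  have hsucc : ∀ k : ℕ, ∀ A, MeasurableSet[𝒢 (Nat.succPNat k)] A →
      ∫⁻ ω in A, E (Nat.succPNat (k + 1)) ω ∂Pr = ∫⁻ ω in A, E (Nat.succPNat k) ω ∂Pr :=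
    fun k => hmart _ _ (Nat.succPNat_le_succPNat.2 k.le_succ)
  have hle : ∀ᵐ ω ∂Pr, valueAt M τ ω ≤ liminf (fun k => stopped E τ k ω) atTop := by
    filter_upwards [ae_exists_tendsto hE hsucc (hone _)] with ω ⟨l, hl⟩
    unfold valueAt
    -- At `τ = ∞` almost sure convergence identifies limsup and liminf of `E`, which reconciles `M_∞
    -- = limsup M_n` with the liminf in Fatou's lemma. At finite `τ` the stopped process is
    -- eventually constant.
    rcases h : τ ω with _ | n
    · have hs : (fun k => stopped E τ k ω) = fun k => E (Nat.succPNat k) ω := by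
        funext k
        exact stopped_of_gt E τ ω k (by rw [h]; exact le_top)
      have hl' : Tendsto (fun n : ℕ+ => E n ω) atTop (nhds l) := by
        refine (hl.comp OrderIso.pnatIsoNat.tendsto_atTop).congr fun n => ?_
        change E (Nat.succPNat (PNat.natPred n)) ω = _
        rw [PNat.succPNat_natPred]
      rw [hs, hl.liminf_eq]
      change limsup (fun n : ℕ+ => ENNReal.ofReal (M n ω)) atTop ≤ l
      rw [← hl'.limsup_eq]
      exact limsup_le_limsup (Eventually.of_forall fun n => hM n ω)
    · change ENNReal.ofReal (M n ω) ≤ _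
      obtain ⟨j, rfl⟩ : ∃ j, Nat.succPNat j = n := ⟨n.natPred, PNat.succPNat_natPred n⟩
      have : Tendsto (fun k => stopped E τ k ω) atTop (nhds (E (Nat.succPNat j) ω)) :=
        tendsto_const_nhds.congr' (by
          filter_upwards [eventually_ge_atTop j] with k hk
          exact (stopped_of_eq E τ ω j h k hk).symm)
      rw [this.liminf_eq]
      exact hM _ _
  calc ∫⁻ ω, valueAt M τ ω ∂Pr
      ≤ ∫⁻ ω, liminf (fun k => stopped E τ k ω) atTop ∂Pr := lintegral_mono_ae hle
    _ ≤ liminf (fun k => ∫⁻ ω, stopped E τ k ω ∂Pr) atTop :=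
        lintegral_liminf_le fun k => measurable_stopped hE hτ k
    _ ≤ 1 := by
        simp only [lintegral_stopped hsucc hτ]
        simpa using hone _

end Stopping

/-! ### Scale mixtures of normal likelihoods and their Gaussian mixture -/

section Kernel

/-- The joint density of `n` i.i.d. observations from `N(τ θ, τ²)` with `τ = exp (-t)`, as a
function of their sum `s` and their sum of squares `v`. -/
noncomputable def jointDensity (θ t : ℝ) (n : ℕ) (s v : ℝ) : ℝ :=
  (√(2 * Real.pi))⁻¹ ^ n * Real.exp (n * t) *
    Real.exp (-(v * Real.exp t ^ 2 - 2 * s * θ * Real.exp t + n * θ ^ 2) / 2)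

/-- The mixture of the joint densities over all scales. -/
noncomputable def lscaleMixture (θ : ℝ) (n : ℕ) (s v : ℝ) : ℝ≥0∞ :=
  ∫⁻ t, ENNReal.ofReal (jointDensity θ t n s v)

lemma jointDensity_pos (θ t : ℝ) (n : ℕ) (s v : ℝ) : 0 < jointDensity θ t n s v := by
  unfold jointDensity
  positivity

@[fun_prop]
lemma Measurable.jointDensity {α : Type*} [MeasurableSpace α] {θ t s v : α → ℝ} (n : ℕ)
    (hθ : Measurable θ) (ht : Measurable t) (hs : Measurable s) (hv : Measurable v) :
    Measurable fun a => jointDensity (θ a) (t a) n (s a) (v a) := by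
  unfold TTest.jointDensity
  fun_prop

@[fun_prop]
lemma Measurable.lscaleMixture {α : Type*} [MeasurableSpace α] {θ s v : α → ℝ} (n : ℕ)
    (hθ : Measurable θ) (hs : Measurable s) (hv : Measurable v) :
    Measurable fun a => lscaleMixture (θ a) n (s a) (v a) := by
  unfold TTest.lscaleMixture
  refine Measurable.lintegral_prod_right'
    (f := fun p : α × ℝ => ENNReal.ofReal (TTest.jointDensity (θ p.1) p.2 n (s p.1) (v p.1))) ?_
  fun_prop

lemma gaussianPDFReal_exp_scale (θ t x : ℝ) :
    gaussianPDFReal (Real.exp (-t) * θ) (Real.toNNReal (Real.exp (-t) ^ 2)) x =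
      (√(2 * Real.pi))⁻¹ * Real.exp t *
        Real.exp (-(x ^ 2 * Real.exp t ^ 2 - 2 * x * θ * Real.exp t + θ ^ 2) / 2) := by
  rw [gaussianPDFReal, Real.coe_toNNReal _ (by positivity), Real.sqrt_mul (by positivity),
    Real.sqrt_sq (Real.exp_pos _).le, mul_inv, Real.exp_neg, inv_inv]
  congr 2
  have := (Real.exp_pos t).ne'
  field_simp
  ring

lemma prod_gaussianPDFReal_exp_scale {ι : Type*} (I : Finset ι) (x : ι → ℝ) (θ t : ℝ) :
    ∏ i ∈ I, gaussianPDFReal (Real.exp (-t) * θ) (Real.toNNReal (Real.exp (-t) ^ 2)) (x i) =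
      jointDensity θ t I.card (∑ i ∈ I, x i) (∑ i ∈ I, x i ^ 2) := by
  simp only [gaussianPDFReal_exp_scale, Finset.prod_mul_distrib, Finset.prod_const, jointDensity,
    ← Real.exp_sum]
  rw [← Real.exp_nat_mul]
  congr 2
  rw [← Finset.sum_div, Finset.sum_neg_distrib, Finset.sum_add_distrib, Finset.sum_sub_distrib,
    Finset.sum_const, nsmul_eq_mul, Finset.sum_mul, Finset.mul_sum, Finset.sum_mul, Finset.sum_mul]

lemma jointDensity_scale (θ t a : ℝ) (n : ℕ) (s v : ℝ) :
    jointDensity θ t n (Real.exp a * s) (Real.exp a ^ 2 * v) =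
      Real.exp (-(n * a)) * jointDensity θ (t + a) n s v := by
  have h : Real.exp (n * (t + a)) = Real.exp (n * t) * Real.exp (n * a) := by
    rw [← Real.exp_add]; ring_nf
  rw [jointDensity, jointDensity, h, Real.exp_neg, Real.exp_add t a]
  have := (Real.exp_pos (n * a)).ne'
  field_simp

/-- Translation invariance of `dt`, that is, invariance of `dτ/τ`. The factor does not involve `θ`,
so it cancels in likelihood ratios. -/
lemma lscaleMixture_scale (θ a : ℝ) (n : ℕ) (s v : ℝ) :
    lscaleMixture θ n (Real.exp a * s) (Real.exp a ^ 2 * v) =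
      ENNReal.ofReal (Real.exp (-(n * a))) * lscaleMixture θ n s v := by
  unfold lscaleMixture
  simp_rw [jointDensity_scale, ENNReal.ofReal_mul (Real.exp_pos _).le]
  rw [lintegral_const_mul' _ _ ENNReal.ofReal_ne_top,
    lintegral_add_right_eq_self (fun t => ENNReal.ofReal (jointDensity θ t n s v)) a]

lemma lscaleMixture_zero_left (n : ℕ) (s v : ℝ) :
    lscaleMixture 0 n s v = lscaleMixture 0 n 0 v := by
  simp [lscaleMixture, jointDensity]

lemma lscaleMixture_ne_zero (θ : ℝ) (n : ℕ) (s v : ℝ) : lscaleMixture θ n s v ≠ 0 := by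
  unfold lscaleMixture
  rw [← setLIntegral_univ]
  refine ((setLIntegral_pos_iff (by fun_prop)).2 ?_).ne'
  have : Function.support (fun t => ENNReal.ofReal (jointDensity θ t n s v)) = univ := by
    ext t
    simp [jointDensity_pos]
  simp [this]

/-- Multiplicative change of variables on the positive half line. -/
lemma setLIntegral_Ioi_eq_lintegral_exp_neg (g : ℝ → ℝ≥0∞) :
    ∫⁻ τ in Ioi 0, g τ = ∫⁻ t, ENNReal.ofReal (Real.exp (-t)) * g (Real.exp (-t)) := by
  have him : (fun t => Real.exp (-t)) '' univ = Ioi 0 := by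
    ext y
    simp only [image_univ, mem_range, mem_Ioi]
    exact ⟨fun ⟨t, ht⟩ => ht ▸ Real.exp_pos _, fun hy => ⟨-Real.log y, by simp [Real.exp_log hy]⟩⟩
  rw [← him, lintegral_image_eq_lintegral_abs_deriv_mul MeasurableSet.univ
    (f' := fun t => -Real.exp (-t)) (fun t _ => ?_) (fun a _ b _ h => ?_), setLIntegral_univ]
  · simp
  · exact (by simpa using (hasDerivAt_neg t).exp :
      HasDerivAt (fun t => Real.exp (-t)) (-Real.exp (-t)) t).hasDerivWithinAt
  · simpa using h

/-- With `y = exp t` this is a multiple of the convergent integral of `y ^ (n - 1) * exp (-v y² /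
2)` over `y > 0`. -/
lemma lscaleMixture_zero_ne_top {n : ℕ} (hn : 0 < n) (s : ℝ) {v : ℝ} (hv : 0 < v) :
    lscaleMixture 0 n s v ≠ ∞ := by
  have hint := integrableOn_rpow_mul_exp_neg_mul_sq (b := v / 2) (by positivity)
    (s := (n : ℝ) - 1) (by have : (0 : ℝ) < n := by exact_mod_cast hn
                           linarith)
  have h := hint.hasFiniteIntegral
  rw [HasFiniteIntegral, setLIntegral_Ioi_eq_lintegral_exp_neg,
    ← (Measure.measurePreserving_neg volume).lintegral_comp_emb
      (MeasurableEquiv.neg ℝ).measurableEmbedding] at h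
  have hK : lscaleMixture 0 n s v = ENNReal.ofReal ((√(2 * Real.pi))⁻¹ ^ n) *
      ∫⁻ t, ENNReal.ofReal (Real.exp (- -t)) *
        ‖Real.exp (- -t) ^ ((n : ℝ) - 1) * Real.exp (-(v / 2) * Real.exp (- -t) ^ 2)‖ₑ := by
    rw [← lintegral_const_mul' _ _ ENNReal.ofReal_ne_top]
    refine lintegral_congr fun t => ?_
    rw [Real.enorm_of_nonneg (by positivity), ← ENNReal.ofReal_mul (by positivity),
      ← ENNReal.ofReal_mul (by positivity), jointDensity, neg_neg, ← Real.exp_mul, mul_assoc,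
      ← Real.exp_add, ← Real.exp_add, ← Real.exp_add]
    congr 3
    ring
  rw [hK]
  exact ENNReal.mul_ne_top ENNReal.ofReal_ne_top h.ne

/-- The Jacobian `exp (-t)` cancels the `1 / τ`. No finiteness is needed: a divergent integral is
`0` on both sides. -/
lemma scaleMixture_eq (θ : ℝ) (n : ℕ) (x : ℕ → ℝ) :
    scaleMixture θ n x = (lscaleMixture θ n (partialSum n x) (sumSq n x)).toReal := by
  have hm : Measurable fun τ : ℝ => (∏ i ∈ Finset.range n,
      gaussianPDFReal (τ * θ) (Real.toNNReal (τ ^ 2)) (x i)) / τ := by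
    refine Measurable.div (Finset.measurable_prod _ fun i _ => ?_) measurable_id
    exact measurable_uncurry_gaussianPDFReal.comp
      ((measurable_id.mul_const θ).prodMk
        ((measurable_id.pow_const 2).real_toNNReal.prodMk measurable_const))
  rw [scaleMixture, integral_eq_lintegral_of_nonneg_ae
    ((ae_restrict_mem measurableSet_Ioi).mono fun τ hτ => ?_) hm.aestronglyMeasurable,
    setLIntegral_Ioi_eq_lintegral_exp_neg, lscaleMixture]
  · congr 1
    refine lintegral_congr fun t => ?_
    rw [prod_gaussianPDFReal_exp_scale, ← ENNReal.ofReal_mul (Real.exp_pos _).le,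
      mul_div_cancel₀ _ (Real.exp_pos _).ne', Finset.card_range]
    rfl
  · exact div_nonneg (Finset.prod_nonneg fun i _ => gaussianPDFReal_nonneg _ _ _) (le_of_lt hτ)

/-- Completing the square in the mean parameter. -/
lemma gaussianPDFReal_mul_jointDensity {c : ℝ} (hc : 0 < c) (θ t : ℝ) (n : ℕ) (s v : ℝ) :
    gaussianPDFReal 0 (Real.toNNReal (c ^ 2)⁻¹) θ * jointDensity θ t n s v =
      √(c ^ 2 / (n + c ^ 2)) * jointDensity 0 t n 0 (v - s ^ 2 / (n + c ^ 2)) *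
        gaussianPDFReal (s * Real.exp t / (n + c ^ 2)) (Real.toNNReal (n + c ^ 2)⁻¹) θ := by
  have hp : (0 : ℝ) < n + c ^ 2 := by positivity
  rw [gaussianPDFReal, gaussianPDFReal, Real.coe_toNNReal _ (by positivity),
    Real.coe_toNNReal _ (by positivity), jointDensity, jointDensity]
  have h1 : (√(2 * Real.pi * (c ^ 2)⁻¹))⁻¹ =
      √(c ^ 2 / (n + c ^ 2)) * (√(2 * Real.pi * (n + c ^ 2)⁻¹))⁻¹ := by
    rw [← Real.sqrt_inv, ← Real.sqrt_inv, ← Real.sqrt_mul (by positivity)]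
    congr 1
    field_simp
  have h2 : Real.exp (-(θ - 0) ^ 2 / (2 * (c ^ 2)⁻¹)) *
      Real.exp (-(v * Real.exp t ^ 2 - 2 * s * θ * Real.exp t + n * θ ^ 2) / 2) =
      Real.exp (-((v - s ^ 2 / (n + c ^ 2)) * Real.exp t ^ 2 - 2 * 0 * 0 * Real.exp t
        + n * 0 ^ 2) / 2) *
      Real.exp (-(θ - s * Real.exp t / (n + c ^ 2)) ^ 2 / (2 * (n + c ^ 2)⁻¹)) := by
    rw [← Real.exp_add, ← Real.exp_add]
    congr 1
    field_simp
    ring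
  rw [h1]
  linear_combination (√(c ^ 2 / (n + c ^ 2)) * (√(2 * Real.pi * (n + c ^ 2)⁻¹))⁻¹ *
    (√(2 * Real.pi))⁻¹ ^ n * Real.exp (n * t)) * h2

/-- By Tonelli `θ` is integrated first; after completing the square it enters only through a normal
density of mass one. -/
lemma lintegral_lscaleMixture {c : ℝ} (hc : 0 < c) (n : ℕ) (s v : ℝ) :
    ∫⁻ θ, lscaleMixture θ n s v ∂(gaussianReal 0 (Real.toNNReal (c ^ 2)⁻¹)) =
      ENNReal.ofReal √(c ^ 2 / (n + c ^ 2)) *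
        lscaleMixture 0 n 0 (v - s ^ 2 / (n + c ^ 2)) := by
  have hv : Real.toNNReal (c ^ 2)⁻¹ ≠ 0 := by
    simp only [ne_eq, Real.toNNReal_eq_zero, not_le]; positivity
  have hv' : Real.toNNReal (n + c ^ 2)⁻¹ ≠ 0 := by
    simp only [ne_eq, Real.toNNReal_eq_zero, not_le]; positivity
  unfold lscaleMixture
  rw [lintegral_lintegral_swap (by fun_prop),
    ← lintegral_const_mul' _ _ ENNReal.ofReal_ne_top]
  refine lintegral_congr fun t => ?_
  rw [gaussianReal_of_var_ne_zero _ hv, lintegral_withDensity_eq_lintegral_mul _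
    (measurable_gaussianPDF _ _) (by fun_prop)]
  simp only [Pi.mul_apply, gaussianPDF, ← ENNReal.ofReal_mul (gaussianPDFReal_nonneg _ _ _),
    gaussianPDFReal_mul_jointDensity hc]
  rw [← ENNReal.ofReal_mul (Real.sqrt_nonneg _)]
  simp_rw [ENNReal.ofReal_mul (mul_nonneg (Real.sqrt_nonneg _) (jointDensity_pos _ _ _ _ _).le)]
  rw [lintegral_const_mul' _ _ ENNReal.ofReal_ne_top]
  have := lintegral_gaussianPDFReal_eq_one (s * Real.exp t / (n + c ^ 2)) hv'
  rw [this, mul_one]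

/-- The scaling relation with `exp a = √r`; this is the source of the exponent `-n/2` in the
statistic. -/
lemma lscaleMixture_zero_mul (n : ℕ) {v r : ℝ} (hr : 0 < r) :
    lscaleMixture 0 n 0 (r * v) = ENNReal.ofReal (r ^ (-(n : ℝ) / 2)) * lscaleMixture 0 n 0 v := by
  have h := lscaleMixture_scale 0 (Real.log r / 2) n 0 v
  have h1 : Real.exp (Real.log r / 2) ^ 2 = r := by
    rw [← Real.exp_nat_mul]
    push_cast
    rw [mul_div_cancel₀ _ two_ne_zero, Real.exp_log hr]
  have h2 : Real.exp (-(n * (Real.log r / 2))) = r ^ (-(n : ℝ) / 2) := by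
    rw [Real.rpow_def_of_pos hr]
    ring_nf
  rwa [h1, h2, mul_zero] at h

/-- Half of the Gaussian mixture of the likelihoods dominates the semi-one-sided statistic. -/
lemma ofReal_mul_lscaleMixture_le {c : ℝ} (hc : 0 < c) {n : ℕ} (hn : 0 < n) {s v : ℝ} (hv : 0 < v)
    (hsv : s ^ 2 ≤ n * v) :
    ENNReal.ofReal (√(c ^ 2 / (n + c ^ 2)) *
      ((1 - s ^ 2 / ((n + c ^ 2) * v)) ^ (-(n : ℝ) / 2)
      - (1 - (min s 0) ^ 2 / ((n + c ^ 2) * v)) ^ (-(n : ℝ) / 2))) * lscaleMixture 0 n s v ≤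
    ∫⁻ θ, lscaleMixture θ n s v ∂(halfGaussian c) := by
  rcases le_total s 0 with hs | hs
  · simp [min_eq_left hs]
  have hp : (0 : ℝ) < n + c ^ 2 := by positivity
  have hr : 0 < 1 - s ^ 2 / ((n + c ^ 2) * v) := by
    rw [sub_pos, div_lt_one (by positivity)]
    nlinarith [mul_pos (pow_pos hc 2) hv]
  set a := √(c ^ 2 / (n + c ^ 2)) with ha
  set g := (1 - s ^ 2 / ((n + c ^ 2) * v)) ^ (-(n : ℝ) / 2) with hg
  have ha0 : 0 ≤ a := Real.sqrt_nonneg _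
  have hfull : ∫⁻ θ, lscaleMixture θ n s v ∂(gaussianReal 0 (Real.toNNReal (c ^ 2)⁻¹)) =
      ENNReal.ofReal (a * g) * lscaleMixture 0 n 0 v := by
    rw [lintegral_lscaleMixture hc, ENNReal.ofReal_mul ha0, mul_assoc,
      ← lscaleMixture_zero_mul n hr]
    congr 2
    field_simp
  have hzero : ∫⁻ θ, lscaleMixture θ n 0 v ∂(gaussianReal 0 (Real.toNNReal (c ^ 2)⁻¹)) =
      ENNReal.ofReal a * lscaleMixture 0 n 0 v := by
    rw [lintegral_lscaleMixture hc]
    simp [ha]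
  -- For `θ < 0 ≤ s` the cross term `s θ exp t` is nonpositive, so putting `s = 0` only increases
  -- the density. Enlarging the domain to all `θ` then costs a factor two, by symmetry at `s = 0`.
  have hneg : ∫⁻ θ in (Ici 0)ᶜ, lscaleMixture θ n s v
        ∂(gaussianReal 0 (Real.toNNReal (c ^ 2)⁻¹)) ≤
      ENNReal.ofReal a * lscaleMixture 0 n 0 v := by
    rw [← hzero]
    refine (setLIntegral_mono' measurableSet_Ici.compl fun θ hθ => ?_).trans
      (setLIntegral_le_lintegral _ _)
    have hθ' : θ < 0 := by simpa using hθ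
    refine lintegral_mono fun t => ENNReal.ofReal_le_ofReal ?_
    unfold jointDensity
    refine mul_le_mul_of_nonneg_left (Real.exp_le_exp.2 ?_) (by positivity)
    have : s * θ * Real.exp t ≤ 0 :=
      mul_nonpos_of_nonpos_of_nonneg (mul_nonpos_of_nonneg_of_nonpos hs hθ'.le) (Real.exp_pos t).le
    linarith
  have hsplit := lintegral_add_compl (μ := gaussianReal 0 (Real.toNNReal (c ^ 2)⁻¹))
    (fun θ => lscaleMixture θ n s v) (measurableSet_Ici (a := (0 : ℝ)))
  rw [min_eq_right hs, lscaleMixture_zero_left]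
  have hone : (1 - (0 : ℝ) ^ 2 / ((n + c ^ 2) * v)) ^ (-(n : ℝ) / 2) = 1 := by simp
  rw [hone, mul_sub, mul_one, ENNReal.ofReal_sub _ ha0, halfGaussian]
  rw [ENNReal.sub_mul fun _ _ => lscaleMixture_zero_ne_top hn 0 hv, tsub_le_iff_right, ← hfull,
    ← hsplit]
  gcongr

end Kernel

/-! ### Likelihood ratios on the scale invariant σ-algebra -/

section Pushforward

/-- The σ-algebra of measurable sets that are invariant under positive scaling. -/
@[reducible] def scaleInvariantSets (n : ℕ) : MeasurableSpace (Fin n → ℝ) where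
  MeasurableSet' B := MeasurableSet B ∧
    ∀ (x : Fin n → ℝ) (r : ℝ), 0 < r → ((fun i => r * x i) ∈ B ↔ x ∈ B)
  measurableSet_empty := ⟨MeasurableSet.empty, by simp⟩
  measurableSet_compl B hB := ⟨hB.1.compl, fun x r hr => not_congr (hB.2 x r hr)⟩
  measurableSet_iUnion f hf := ⟨MeasurableSet.iUnion fun i => (hf i).1, fun x r hr => by
    simp only [mem_iUnion]
    exact exists_congr fun i => (hf i).2 x r hr⟩

/-- Preimages under invariant functions are invariant sets, and conversely the indicator of an
invariant set is an invariant function. -/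
lemma scaleInvariantSigma_eq_comap {Ω : Type*} (X : ℕ → Ω → ℝ) (n : ℕ) :
    scaleInvariantSigma X n =
      (scaleInvariantSets n).comap (fun ω (i : Fin n) => X i ω) := by
  apply le_antisymm
  · refine iSup_le fun f => ?_
    rintro _ ⟨C, hC, rfl⟩
    refine ⟨f.1 ⁻¹' C, ⟨f.2.1 hC, fun x r hr => ?_⟩, rfl⟩
    simp only [mem_preimage, f.2.2 x r hr]
  · rintro _ ⟨B, hB, rfl⟩
    have hf : IsScaleInvariant (B.indicator (fun _ => (1 : ℝ))) := by
      refine ⟨measurable_const.indicator hB.1, fun x r hr => ?_⟩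
      by_cases hx : x ∈ B
      · rw [indicator_of_mem hx, indicator_of_mem ((hB.2 x r hr).2 hx)]
      · rw [indicator_of_notMem hx, indicator_of_notMem (fun h => hx ((hB.2 x r hr).1 h))]
    refine le_iSup (fun f : {f : (Fin n → ℝ) → ℝ // IsScaleInvariant f} =>
      MeasurableSpace.comap (fun ω => f.1 (fun i => X i ω)) inferInstance) ⟨_, hf⟩ _ ?_
    refine ⟨{1}, measurableSet_singleton _, ?_⟩
    ext ω
    by_cases h : (fun i : Fin n => X i ω) ∈ B <;> simp [h]

lemma measurable_scaleInvariantSigma {Ω β : Type*} [MeasurableSpace β] (X : ℕ → Ω → ℝ) {n : ℕ}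
    {f : (Fin n → ℝ) → β} (hf : Measurable f)
    (hinv : ∀ (x : Fin n → ℝ) (r : ℝ), 0 < r → f (fun i => r * x i) = f x) :
    Measurable[scaleInvariantSigma X n] fun ω => f (fun i => X i ω) := by
  intro C hC
  rw [scaleInvariantSigma_eq_comap]
  refine ⟨f ⁻¹' C, ⟨hf hC, fun x r hr => ?_⟩, rfl⟩
  simp only [mem_preimage, hinv x r hr]

lemma map_eq_pi {Ω : Type*} [MeasurableSpace Ω] {X : ℕ → Ω → ℝ} (hX : ∀ i, Measurable (X i))
    {P : Measure ℝ} {Pr : Measure Ω} (h : IsIID X P Pr) (n : ℕ) :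
    Pr.map (fun ω (i : Fin n) => X i ω) = Measure.pi fun _ : Fin n => P := by
  have := iIndepFun.map_fun_eq_pi_map (f := fun (i : Fin n) => X i)
    (fun i => (hX i).aemeasurable) (h.1.precomp Fin.val_injective)
  simpa only [h.2] using this

lemma isIID_infinitePi (P : Measure ℝ) [IsProbabilityMeasure P] :
    IsIID (fun i (x : ℕ → ℝ) => x i) P (Measure.infinitePi fun _ => P) :=
  ⟨iIndepFun_infinitePi (X := fun _ x => x) fun _ => measurable_id,
    fun i => Measure.infinitePi_map_eval (fun _ => P) i⟩

/-- Marginalizing out the last coordinate of a finite power of a probability measure. -/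
lemma pi_preimage_castLE (P : Measure ℝ) [IsProbabilityMeasure P] {n m : ℕ} (h : n ≤ m)
    {B : Set (Fin n → ℝ)} (hB : MeasurableSet B) :
    Measure.pi (fun _ : Fin m => P) ((fun x i => x (Fin.castLE h i)) ⁻¹' B) =
      Measure.pi (fun _ : Fin n => P) B := by
  have hX : ∀ i : ℕ, Measurable fun x : ℕ → ℝ => x i := measurable_pi_apply
  rw [← map_eq_pi hX (isIID_infinitePi P) m, ← map_eq_pi hX (isIID_infinitePi P) n,
    Measure.map_apply (by fun_prop) hB,
    Measure.map_apply (by fun_prop) (hB.preimage (by fun_prop))]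
  rfl

lemma pi_gaussianReal_eq_withDensity (θ t : ℝ) (n : ℕ) :
    Measure.pi (fun _ : Fin n =>
        gaussianReal (Real.exp (-t) * θ) (Real.toNNReal (Real.exp (-t) ^ 2))) =
      volume.withDensity fun x : Fin n → ℝ =>
        ENNReal.ofReal (jointDensity θ t n (∑ i, x i) (∑ i, x i ^ 2)) := by
  have hv : Real.toNNReal (Real.exp (-t) ^ 2) ≠ 0 := by
    simp only [ne_eq, Real.toNNReal_eq_zero, not_le]; positivity
  refine Measure.pi_eq fun s hs => ?_
  set m := Real.exp (-t) * θ
  set v := Real.toNNReal (Real.exp (-t) ^ 2)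
  have hJ : ∀ x : Fin n → ℝ, jointDensity θ t n (∑ i, x i) (∑ i, x i ^ 2) =
      ∏ i, gaussianPDFReal m v (x i) := fun x => by
    rw [prod_gaussianPDFReal_exp_scale, Finset.card_univ, Fintype.card_fin]
  have hind : ∀ x : Fin n → ℝ,
      (pi univ s).indicator (fun x => ENNReal.ofReal (∏ i, gaussianPDFReal m v (x i))) x =
      ENNReal.ofReal (∏ i, (s i).indicator (gaussianPDFReal m v) (x i)) := by
    intro x
    by_cases hx : x ∈ pi univ s
    · rw [indicator_of_mem hx]
      congr 1
      exact Finset.prod_congr rfl fun i _ => (indicator_of_mem (hx i (mem_univ i)) _).symm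
    · rw [indicator_of_notMem hx]
      simp only [Set.mem_pi, mem_univ, true_imp_iff, not_forall] at hx
      obtain ⟨i, hi⟩ := hx
      rw [Finset.prod_eq_zero (Finset.mem_univ i) (indicator_of_notMem hi _), ENNReal.ofReal_zero]
  have hint : ∀ i, Integrable ((s i).indicator (gaussianPDFReal m v)) := fun i =>
    (integrable_gaussianPDFReal m v).indicator (hs i)
  have h0 : ∀ i, 0 ≤ (s i).indicator (gaussianPDFReal m v) := fun i =>
    indicator_nonneg fun x _ => gaussianPDFReal_nonneg _ _ _
  rw [withDensity_apply _ (MeasurableSet.univ_pi hs),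
    ← lintegral_indicator (MeasurableSet.univ_pi hs)]
  simp_rw [hJ, hind]
  rw [volume_pi, ← ofReal_integral_eq_lintegral_ofReal (Integrable.fintype_prod hint)
    (Eventually.of_forall fun x => Finset.prod_nonneg fun i _ => h0 i _),
    integral_fintype_prod_eq_prod (fun i => (s i).indicator (gaussianPDFReal m v)),
    ENNReal.ofReal_prod_of_nonneg fun i _ => integral_nonneg (h0 i)]
  refine Finset.prod_congr rfl fun i _ => ?_
  rw [integral_indicator (hs i), gaussianReal_apply_eq_integral _ hv]

lemma lintegral_smul_exp (n : ℕ) (t : ℝ) {g : (Fin n → ℝ) → ℝ≥0∞} (hg : Measurable g) :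
    ∫⁻ x, g x = ENNReal.ofReal (Real.exp (-(n * t))) * ∫⁻ x, g (Real.exp (-t) • x) := by
  have h := Measure.map_addHaar_smul (volume : Measure (Fin n → ℝ)) (Real.exp_pos (-t)).ne'
  have h2 := lintegral_map (μ := volume) hg (measurable_const_smul (Real.exp (-t)))
  rw [h, lintegral_smul_measure, smul_eq_mul, Module.finrank_fin_fun, ← Real.exp_nat_mul,
    ← Real.exp_neg, abs_of_pos (Real.exp_pos _)] at h2
  rw [← h2, ← mul_assoc, ← ENNReal.ofReal_mul (Real.exp_pos _).le, ← Real.exp_add]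
  ring_nf
  simp

/-- The ratio of the scale mixtures is the likelihood ratio on the scale invariant sets. -/
lemma setLIntegral_ratio {n : ℕ} (hn : 0 < n) (θ b : ℝ) {B : Set (Fin n → ℝ)}
    (hB : MeasurableSet[scaleInvariantSets n] B) :
    ∫⁻ x in B, lscaleMixture θ n (∑ i, x i) (∑ i, x i ^ 2) /
        lscaleMixture 0 n (∑ i, x i) (∑ i, x i ^ 2)
      ∂(Measure.pi fun _ : Fin n => gaussianReal 0 (Real.toNNReal (Real.exp (-b) ^ 2))) =
    Measure.pi (fun _ : Fin n => gaussianReal θ 1) B := by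
  have : Nonempty (Fin n) := ⟨⟨0, hn⟩⟩
  obtain ⟨hBm, hBi⟩ := hB
  have hP0 := pi_gaussianReal_eq_withDensity 0 b n
  have hP1 := pi_gaussianReal_eq_withDensity θ 0 n
  simp only [mul_zero] at hP0
  simp only [neg_zero, Real.exp_zero, one_mul, one_pow, Real.toNNReal_one] at hP1
  have hI : Measurable (B.indicator (1 : (Fin n → ℝ) → ℝ≥0∞)) := measurable_one.indicator hBm
  rw [hP0, hP1, withDensity_apply _ hBm, restrict_withDensity hBm,
    lintegral_withDensity_eq_lintegral_mul _ (by fun_prop) (by fun_prop),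
    ← lintegral_indicator hBm, ← lintegral_indicator hBm]
  -- `F` opens up the scale integral in the numerator. `G` is what it becomes under `x ↦ exp (-t) •
  -- x`: the alternative now has scale one, and `t` has moved to the null density.
  let F : ℝ → (Fin n → ℝ) → ℝ≥0∞ := fun t x =>
    B.indicator 1 x * ENNReal.ofReal (jointDensity 0 b n (∑ i, x i) (∑ i, x i ^ 2)) *
      (lscaleMixture 0 n (∑ i, x i) (∑ i, x i ^ 2))⁻¹ *
      ENNReal.ofReal (jointDensity θ t n (∑ i, x i) (∑ i, x i ^ 2))
  let G : ℝ → (Fin n → ℝ) → ℝ≥0∞ := fun t x =>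
    B.indicator 1 x * ENNReal.ofReal (jointDensity θ 0 n (∑ i, x i) (∑ i, x i ^ 2)) *
      (lscaleMixture 0 n (∑ i, x i) (∑ i, x i ^ 2))⁻¹ *
      ENNReal.ofReal (jointDensity 0 (b - t) n (∑ i, x i) (∑ i, x i ^ 2))
  have hF : Measurable (Function.uncurry F) := by
    refine Measurable.mul (Measurable.mul (Measurable.mul (hI.comp measurable_snd) ?_) ?_) ?_ <;>
      fun_prop
  have hG : Measurable (Function.uncurry G) := by
    refine Measurable.mul (Measurable.mul (Measurable.mul (hI.comp measurable_snd) ?_) ?_) ?_ <;>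
      fun_prop
  have hFG : ∀ t, ∫⁻ x, F t x = ∫⁻ x, G t x := by
    intro t
    rw [lintegral_smul_exp n t (g := F t) (hF.comp measurable_prodMk_left),
      ← lintegral_const_mul' _ _ ENNReal.ofReal_ne_top]
    refine lintegral_congr fun x => ?_
    have hS : ∑ i, (Real.exp (-t) • x) i = Real.exp (-t) * ∑ i, x i := by
      simp [Finset.mul_sum]
    have hV : ∑ i, (Real.exp (-t) • x) i ^ 2 = Real.exp (-t) ^ 2 * ∑ i, x i ^ 2 := by
      simp [Finset.mul_sum, mul_pow]
    have hind : B.indicator (1 : (Fin n → ℝ) → ℝ≥0∞) (Real.exp (-t) • x) = B.indicator 1 x := by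
      have hmem : Real.exp (-t) • x ∈ B ↔ x ∈ B := hBi x _ (Real.exp_pos _)
      by_cases hx : x ∈ B
      · simp [hx, hmem.2 hx]
      · simp [hx, mt hmem.1 hx]
    simp only [F, G, hS, hV, hind, jointDensity_scale, lscaleMixture_scale,
      ENNReal.ofReal_mul (Real.exp_pos _).le, add_neg_cancel, ← sub_eq_add_neg]
    have hE : ENNReal.ofReal (Real.exp (-(n * t))) * ENNReal.ofReal (Real.exp (-(n * -t))) = 1 := by
      rw [← ENNReal.ofReal_mul (Real.exp_pos _).le, ← Real.exp_add]
      ring_nf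
      simp
    have hE0 : ENNReal.ofReal (Real.exp (-(n * -t))) ≠ 0 := by simp [Real.exp_pos]
    rw [ENNReal.mul_inv (Or.inl hE0) (Or.inl ENNReal.ofReal_ne_top)]
    have hE1 := ENNReal.mul_inv_cancel hE0 ENNReal.ofReal_ne_top
    generalize ENNReal.ofReal (Real.exp (-(n * -t))) = p at *
    generalize ENNReal.ofReal (Real.exp (-(n * t))) = q at *
    generalize (lscaleMixture 0 n (∑ i, x i) (∑ i, x i ^ 2))⁻¹ = d
    generalize ENNReal.ofReal (jointDensity 0 (b - t) n (∑ i, x i) (∑ i, x i ^ 2)) = j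
    generalize ENNReal.ofReal (jointDensity θ 0 n (∑ i, x i) (∑ i, x i ^ 2)) = k
    generalize B.indicator (1 : (Fin n → ℝ) → ℝ≥0∞) x = z
    calc q * (z * (p * j) * (p⁻¹ * d) * (p * k))
        = (q * p) * (p * p⁻¹) * (z * k * d * j) := by ring
      _ = z * k * d * j := by rw [hE, hE1, one_mul, one_mul]
  calc _ = ∫⁻ x, ∫⁻ t, F t x := by
        refine lintegral_congr fun x => ?_
        simp only [F]
        rw [lintegral_const_mul _ (by fun_prop)]
        by_cases hx : x ∈ B
        · simp only [indicator_of_mem hx, Pi.mul_apply, Pi.one_apply, one_mul, lscaleMixture,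
            div_eq_mul_inv]
          ring
        · simp [hx]
    _ = ∫⁻ t, ∫⁻ x, F t x := (lintegral_lintegral_swap hF.aemeasurable).symm
    _ = ∫⁻ t, ∫⁻ x, G t x := lintegral_congr hFG
    _ = ∫⁻ x, ∫⁻ t, G t x := lintegral_lintegral_swap hG.aemeasurable
    _ = _ := by
        refine lintegral_congr_ae ?_
        -- Off the null set `{0}`, integrating the null density over `b - t` reproduces the
        -- denominator, which is finite and nonzero there, so the two cancel and `b` disappears.
        filter_upwards [compl_mem_ae_iff.2 (measure_singleton (0 : Fin n → ℝ))] with x hx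
        have hV : 0 < ∑ i, x i ^ 2 := by
          obtain ⟨i, hi⟩ := Function.ne_iff.1 (show x ≠ 0 from hx)
          exact Finset.sum_pos' (fun _ _ => sq_nonneg _) ⟨i, Finset.mem_univ i, by
            have : x i ≠ 0 := hi
            positivity⟩
        simp only [G]
        rw [lintegral_const_mul _ (by fun_prop),
          lintegral_sub_left_eq_self (fun t => ENNReal.ofReal (jointDensity 0 t n _ _)) b]
        change _ * lscaleMixture 0 n (∑ i, x i) (∑ i, x i ^ 2) = _
        rw [mul_assoc, ENNReal.inv_mul_cancel (lscaleMixture_ne_zero _ _ _ _)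
          (lscaleMixture_zero_ne_top hn _ hV), mul_one]
        by_cases hx : x ∈ B <;> simp [hx]

end Pushforward

/-! ### The mixture martingale -/

section MixtureMartingale

variable {Ω : Type*} [mΩ : MeasurableSpace Ω]

/-- Twice the mixture of the scale invariant likelihood ratios over the half-Gaussian prior. -/
noncomputable def mixtureLR (c : ℝ) (n : ℕ) (x : Fin n → ℝ) : ℝ≥0∞ :=
  2 * ∫⁻ θ, lscaleMixture θ n (∑ i, x i) (∑ i, x i ^ 2) /
    lscaleMixture 0 n (∑ i, x i) (∑ i, x i ^ 2) ∂(halfGaussian c)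

instance (c : ℝ) : IsFiniteMeasure (halfGaussian c) := by
  unfold halfGaussian; infer_instance

@[fun_prop]
lemma measurable_mixtureLR (c : ℝ) (n : ℕ) : Measurable (mixtureLR c n) := by
  unfold mixtureLR
  refine Measurable.const_mul (Measurable.lintegral_prod_right'
    (f := fun p : (Fin n → ℝ) × ℝ => lscaleMixture p.2 n (∑ i, p.1 i) (∑ i, p.1 i ^ 2) /
      lscaleMixture 0 n (∑ i, p.1 i) (∑ i, p.1 i ^ 2)) ?_) _
  fun_prop

lemma mixtureLR_scale (c : ℝ) (n : ℕ) (x : Fin n → ℝ) (r : ℝ) (hr : 0 < r) :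
    mixtureLR c n (fun i => r * x i) = mixtureLR c n x := by
  obtain ⟨a, rfl⟩ : ∃ a, Real.exp a = r := ⟨Real.log r, Real.exp_log hr⟩
  unfold mixtureLR
  simp only [mul_pow, ← Finset.mul_sum, lscaleMixture_scale]
  congr 1
  refine lintegral_congr fun θ => ?_
  exact ENNReal.mul_div_mul_left _ _ (by simp [Real.exp_pos]) ENNReal.ofReal_ne_top

lemma measurable_mixtureLR_comp (X : ℕ → Ω → ℝ) (hX : ∀ i, Measurable (X i)) (c : ℝ) (n : ℕ+) :
    Measurable[scaleInvariantFiltration X hX n] fun ω => mixtureLR c n (fun i => X i ω) :=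
  measurable_scaleInvariantSigma X (measurable_mixtureLR c n) (mixtureLR_scale c n)

/-- Tonelli reduces this to `setLIntegral_ratio` for each `θ`. The right side is free of `v`, so one
process serves all null variances. -/
lemma setLIntegral_mixtureLR {n : ℕ} (hn : 0 < n) (c : ℝ) {v : ℝ≥0} (hv : v ≠ 0)
    {B : Set (Fin n → ℝ)} (hB : MeasurableSet[scaleInvariantSets n] B) :
    ∫⁻ x in B, mixtureLR c n x ∂(Measure.pi fun _ : Fin n => gaussianReal 0 v) =
      2 * ∫⁻ θ, Measure.pi (fun _ : Fin n => gaussianReal θ 1) B ∂(halfGaussian c) := by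
  -- The standard deviation is written as `exp (-b)`.
  obtain ⟨b, rfl⟩ : ∃ b, Real.toNNReal (Real.exp (-b) ^ 2) = v := by
    refine ⟨-(Real.log v / 2), ?_⟩
    have : (0 : ℝ) < v := NNReal.coe_pos.2 (pos_iff_ne_zero.2 hv)
    rw [← Real.exp_nat_mul]
    push_cast
    rw [neg_neg, mul_div_cancel₀ _ two_ne_zero, Real.exp_log this, Real.toNNReal_coe]
  unfold mixtureLR
  rw [lintegral_const_mul' _ _ (by simp), lintegral_lintegral_swap (by fun_prop)]
  simp_rw [setLIntegral_ratio hn _ b hB]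

lemma setLIntegral_mixtureLR_comp {X : ℕ → Ω → ℝ} (hX : ∀ i, Measurable (X i)) {Pr : Measure Ω}
    {n : ℕ} (hn : 0 < n) (c : ℝ) {v : ℝ≥0} (hv : v ≠ 0) (hP : IsIID X (gaussianReal 0 v) Pr)
    {B : Set (Fin n → ℝ)} (hB : MeasurableSet[scaleInvariantSets n] B) :
    ∫⁻ ω in (fun ω (i : Fin n) => X i ω) ⁻¹' B, mixtureLR c n (fun i => X i ω) ∂Pr =
      2 * ∫⁻ θ, Measure.pi (fun _ : Fin n => gaussianReal θ 1) B ∂(halfGaussian c) := by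
  rw [← setLIntegral_mixtureLR hn c hv hB, ← map_eq_pi hX hP n,
    setLIntegral_map hB.1 (measurable_mixtureLR c n) (by fun_prop)]

/-- The martingale property: both integrals are the mass of the same event under the mixture of
i.i.d. laws, the event being read once in `n` and once in `m` coordinates. -/
lemma setLIntegral_mixtureLR_eq_of_le {X : ℕ → Ω → ℝ} (hX : ∀ i, Measurable (X i))
    {Pr : Measure Ω} (c : ℝ) {v : ℝ≥0} (hv : v ≠ 0) (hP : IsIID X (gaussianReal 0 v) Pr) {n m : ℕ}
    (hn : 0 < n) (hnm : n ≤ m) {A : Set Ω} (hA : MeasurableSet[scaleInvariantSigma X n] A) :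
    ∫⁻ ω in A, mixtureLR c m (fun i => X i ω) ∂Pr =
      ∫⁻ ω in A, mixtureLR c n (fun i => X i ω) ∂Pr := by
  rw [scaleInvariantSigma_eq_comap] at hA
  obtain ⟨B, hB, rfl⟩ := hA
  have hB' : MeasurableSet[scaleInvariantSets m]
      ((fun (x : Fin m → ℝ) i => x (Fin.castLE hnm i)) ⁻¹' B) :=
    ⟨hB.1.preimage (by fun_prop), fun x r hr => hB.2 _ r hr⟩
  rw [setLIntegral_mixtureLR_comp hX hn c hv hP hB]
  simp_rw [← fun θ => pi_preimage_castLE (gaussianReal θ 1) hnm hB.1]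
  exact setLIntegral_mixtureLR_comp hX (hn.trans_le hnm) c hv hP hB'

lemma two_mul_halfGaussian_univ_le_one {c : ℝ} (hc : 0 < c) : 2 * halfGaussian c univ ≤ 1 := by
  have : NullSingletonClass (gaussianReal 0 (Real.toNNReal (c ^ 2)⁻¹)) := nullSingletonClass_gaussianReal (by
    simp only [ne_eq, Real.toNNReal_eq_zero, not_le]; positivity)
  set P := gaussianReal 0 (Real.toNNReal (c ^ 2)⁻¹) with hP
  have h1 : P (Iio 0) = P (Ici 0) := by
    rw [← measure_congr Ioi_ae_eq_Ici]
    have hmap : P.map (fun x => -x) = P := by rw [hP, gaussianReal_map_neg, neg_zero]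
    conv_rhs => rw [← hmap, Measure.map_apply measurable_neg measurableSet_Ioi]
    congr 1
    ext x
    simp
  have h2 := prob_add_prob_compl (μ := P) (measurableSet_Ici (a := (0 : ℝ)))
  rw [compl_Ici, h1] at h2
  rw [halfGaussian, ← hP, Measure.restrict_apply_univ, two_mul, h2]

lemma lintegral_mixtureLR_le_one {X : ℕ → Ω → ℝ} (hX : ∀ i, Measurable (X i)) {Pr : Measure Ω}
    {c : ℝ} (hc : 0 < c) {v : ℝ≥0} (hv : v ≠ 0) (hP : IsIID X (gaussianReal 0 v) Pr) (n : ℕ)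
    (hn : 0 < n) :
    ∫⁻ ω, mixtureLR c n (fun i => X i ω) ∂Pr ≤ 1 := by
  have := setLIntegral_mixtureLR_comp hX hn c hv hP
    (@MeasurableSet.univ _ (scaleInvariantSets n))
  rw [preimage_univ, setLIntegral_univ] at this
  rw [this]
  simpa using two_mul_halfGaussian_univ_le_one hc

end MixtureMartingale

/-! ### The semi-one-sided statistic and its e-process property -/

section Statistic

/-- The semi-one-sided statistic as a function of the values `s` of `S_n` and `v` of `V_n`. -/
noncomputable def semiOneSidedStat (c : ℝ) (n : ℕ) (s v : ℝ) : ℝ :=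
  2 * √(c ^ 2 / (n + c ^ 2)) *
    ((1 - s ^ 2 / ((n + c ^ 2) * v)) ^ (-(n : ℝ) / 2)
      - (1 - (min s 0) ^ 2 / ((n + c ^ 2) * v)) ^ (-(n : ℝ) / 2))

lemma semiOneSidedG_eq (c : ℝ) (n : ℕ) (x : ℕ → ℝ) :
    semiOneSidedG c n x = semiOneSidedStat c n (partialSum n x) (sumSq n x) := rfl

lemma sumSq_nonneg (n : ℕ) (x : ℕ → ℝ) : 0 ≤ sumSq n x :=
  Finset.sum_nonneg fun _ _ => sq_nonneg _

lemma sq_partialSum_le (n : ℕ) (x : ℕ → ℝ) : partialSum n x ^ 2 ≤ n * sumSq n x := by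
  simpa [partialSum, sumSq] using sq_sum_le_card_mul_sum_sq (s := Finset.range n) (f := x)

lemma sq_min_zero_le (s : ℝ) : (min s 0) ^ 2 ≤ s ^ 2 := by
  rcases le_total s 0 with h | h
  · rw [min_eq_left h]
  · rw [min_eq_right h, zero_pow two_ne_zero]; exact sq_nonneg s

lemma one_sub_div_pos {c : ℝ} (hc : 0 < c) {n : ℕ} {s v : ℝ} (hv : 0 < v) (hsv : s ^ 2 ≤ n * v) :
    0 < 1 - s ^ 2 / ((n + c ^ 2) * v) := by
  have hp : (0 : ℝ) < n + c ^ 2 := by positivity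
  rw [sub_pos, div_lt_one (by positivity)]
  nlinarith [mul_pos (pow_pos hc 2) hv]

lemma semiOneSidedStat_of_nonpos (c : ℝ) (n : ℕ) {s : ℝ} (hs : s ≤ 0) (v : ℝ) :
    semiOneSidedStat c n s v = 0 := by
  simp [semiOneSidedStat, min_eq_left hs]

lemma semiOneSidedStat_nonneg {c : ℝ} (hc : 0 < c) {n : ℕ} {s v : ℝ} (hv : 0 ≤ v)
    (hsv : s ^ 2 ≤ n * v) : 0 ≤ semiOneSidedStat c n s v := by
  rcases hv.eq_or_lt with rfl | hv
  · simp [semiOneSidedStat]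
  have hp : (0 : ℝ) < n + c ^ 2 := by positivity
  refine mul_nonneg (by positivity) (sub_nonneg.2 ?_)
  refine Real.rpow_le_rpow_of_nonpos (one_sub_div_pos hc hv hsv) ?_ ?_
  · gcongr 1 - ?_ / _
    exact sq_min_zero_le s
  · have : (0 : ℝ) ≤ n := n.cast_nonneg
    linarith

lemma semiOneSidedG_nonneg {c : ℝ} (hc : 0 < c) (n : ℕ) (x : ℕ → ℝ) : 0 ≤ semiOneSidedG c n x :=
  semiOneSidedStat_nonneg hc (sumSq_nonneg n x) (sq_partialSum_le n x)

lemma twoSidedG_eq {c : ℝ} (hc : 0 < c) {n : ℕ} {s v : ℝ} (hv : 0 < v) (hsv : s ^ 2 ≤ n * v) :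
    twoSidedG c n s v =
      √(c ^ 2 / (n + c ^ 2)) * (1 - s ^ 2 / ((n + c ^ 2) * v)) ^ (-(n : ℝ) / 2) := by
  have hp : (0 : ℝ) < n + c ^ 2 := by positivity
  have hb := one_sub_div_pos hc hv hsv
  rw [twoSidedG, neg_div, Real.rpow_neg hb.le, ← Real.inv_rpow hb.le]
  congr 2
  rw [← div_self (mul_pos hp hv).ne', ← sub_div, inv_div]

lemma semiOneSidedG_eq_twoSidedG {c : ℝ} (hc : 0 < c) (n : ℕ) (x : ℕ → ℝ) :
    semiOneSidedG c n x =
      2 * twoSidedG c n (partialSum n x) (sumSq n x)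
        - 2 * twoSidedG c n (min (partialSum n x) 0) (sumSq n x) := by
  have hsv := sq_partialSum_le n x
  rcases (sumSq_nonneg n x).eq_or_lt with hv | hv
  · have hs : partialSum n x = 0 := by
      rw [← hv, mul_zero] at hsv
      exact pow_eq_zero_iff two_ne_zero |>.1 (le_antisymm hsv (sq_nonneg _))
    simp [semiOneSidedG, twoSidedG, ← hv, hs]
  · rw [twoSidedG_eq hc hv hsv, twoSidedG_eq hc hv ((sq_min_zero_le _).trans hsv), semiOneSidedG]
    ring

lemma measurable_semiOneSidedG_comp {Ω : Type*} [MeasurableSpace Ω] (X : ℕ → Ω → ℝ)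
    (hX : ∀ i, Measurable (X i)) (c : ℝ) (n : ℕ+) :
    Measurable[scaleInvariantFiltration X hX n] fun ω => semiOneSidedG c n (fun i => X i ω) := by
  have h := measurable_scaleInvariantSigma X (n := n)
    (f := fun y => semiOneSidedStat c n (∑ i, y i) (∑ i, y i ^ 2))
    (by unfold semiOneSidedStat; fun_prop) (fun y r hr => by
      have h1 : ∀ a b : ℝ, (r * a) ^ 2 / ((n + c ^ 2) * (r ^ 2 * b)) =
          a ^ 2 / ((n + c ^ 2) * b) := fun a b => by
        rw [mul_pow, mul_left_comm, mul_div_mul_left _ _ (pow_pos hr 2).ne']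
      have h2 : ∀ a : ℝ, min (r * a) 0 = r * min a 0 := fun a => by
        rw [mul_min_of_nonneg _ _ hr.le, mul_zero]
      simp only [mul_pow, ← Finset.mul_sum]
      simp only [semiOneSidedStat, h2, h1])
  simpa only [semiOneSidedG_eq, partialSum, sumSq, Finset.sum_range] using! h

/-- The mixture bound divided by the null mixture, which is finite and nonzero for `V_n > 0`; for
`V_n = 0` the statistic is `0`. -/
lemma ofReal_semiOneSidedG_le {c : ℝ} (hc : 0 < c) {n : ℕ} (hn : 0 < n) (x : ℕ → ℝ) :
    ENNReal.ofReal (semiOneSidedG c n x) ≤ mixtureLR c n (fun i => x i) := by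
  rcases (sumSq_nonneg n x).eq_or_lt with hv | hv
  · simp [semiOneSidedG, ← hv]
  have h := ofReal_mul_lscaleMixture_le hc hn hv (sq_partialSum_le n x)
  have hS : ∑ i : Fin n, x i = partialSum n x := (Finset.sum_range _).symm
  have hV : ∑ i : Fin n, x i ^ 2 = sumSq n x := (Finset.sum_range fun i => x i ^ 2).symm
  have h0 := lscaleMixture_ne_zero 0 n (partialSum n x) (sumSq n x)
  have htop := lscaleMixture_zero_ne_top hn (partialSum n x) hv
  rw [mixtureLR, hS, hV]
  simp_rw [div_eq_mul_inv]
  rw [lintegral_mul_const' _ _ (ENNReal.inv_ne_top.2 h0), ← div_eq_mul_inv, semiOneSidedG,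
    mul_assoc, ENNReal.ofReal_mul zero_le_two, ENNReal.ofReal_ofNat]
  gcongr
  exact (ENNReal.le_div_iff_mul_le (Or.inl h0) (Or.inl htop)).2 h

/-- The full Gaussian mixture is already finite, because `v - s² / (n + c²) > 0` when `s² ≤ n v`. -/
lemma lintegral_lscaleMixture_halfGaussian_ne_top {c : ℝ} (hc : 0 < c) {n : ℕ} (hn : 0 < n)
    {s v : ℝ} (hv : 0 < v) (hsv : s ^ 2 ≤ n * v) :
    ∫⁻ θ, lscaleMixture θ n s v ∂(halfGaussian c) ≠ ∞ := by
  refine ((setLIntegral_le_lintegral (Ici 0) _).trans_lt ?_).ne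
  rw [lintegral_lscaleMixture hc]
  refine ENNReal.mul_lt_top ENNReal.ofReal_lt_top (lt_top_iff_ne_top.2
    (lscaleMixture_zero_ne_top hn 0 ?_))
  have := mul_pos hv (one_sub_div_pos hc hv hsv)
  have hp : (0 : ℝ) < n + c ^ 2 := by positivity
  rwa [mul_sub, mul_one, mul_div_assoc', mul_comm _ v, mul_div_mul_left _ _ hv.ne'] at this

lemma semiOneSidedG_le_integral {c : ℝ} (hc : 0 < c) {n : ℕ} (hn : 0 < n) {x : ℕ → ℝ}
    (hx : sumSq n x ≠ 0) :
    Integrable (fun θ => scaleInvariantLR θ 0 n x) (halfGaussian c) ∧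
      semiOneSidedG c n x ≤ 2 * ∫ θ, scaleInvariantLR θ 0 n x ∂(halfGaussian c) := by
  have hv : 0 < sumSq n x := (sumSq_nonneg n x).lt_of_ne' hx
  have h0 := lscaleMixture_ne_zero 0 n (partialSum n x) (sumSq n x)
  have hh : (fun θ => scaleInvariantLR θ 0 n x) = fun θ =>
      (lscaleMixture θ n (partialSum n x) (sumSq n x) /
        lscaleMixture 0 n (partialSum n x) (sumSq n x)).toReal := by
    funext θ
    rw [scaleInvariantLR, scaleMixture_eq, scaleMixture_eq, ENNReal.toReal_div]
  have hm : Measurable fun θ => lscaleMixture θ n (partialSum n x) (sumSq n x) /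
      lscaleMixture 0 n (partialSum n x) (sumSq n x) := by fun_prop
  have hfin : ∫⁻ θ, lscaleMixture θ n (partialSum n x) (sumSq n x) /
      lscaleMixture 0 n (partialSum n x) (sumSq n x) ∂(halfGaussian c) ≠ ∞ := by
    simp_rw [div_eq_mul_inv]
    rw [lintegral_mul_const' _ _ (ENNReal.inv_ne_top.2 h0)]
    exact ENNReal.mul_ne_top
      (lintegral_lscaleMixture_halfGaussian_ne_top hc hn hv (sq_partialSum_le n x))
      (ENNReal.inv_ne_top.2 h0)
  rw [hh]
  refine ⟨integrable_toReal_of_lintegral_ne_top hm.aemeasurable hfin, ?_⟩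
  rw [integral_toReal hm.aemeasurable (ae_lt_top hm hfin)]
  have h := ofReal_semiOneSidedG_le hc hn x
  have hS : ∑ i : Fin n, x i = partialSum n x := (Finset.sum_range _).symm
  have hV : ∑ i : Fin n, x i ^ 2 = sumSq n x := (Finset.sum_range fun i => x i ^ 2).symm
  rw [mixtureLR, hS, hV,
    ENNReal.ofReal_le_iff_le_toReal (ENNReal.mul_ne_top ENNReal.ofNat_ne_top hfin),
    ENNReal.toReal_mul, ENNReal.toReal_ofNat] at h
  exact h

lemma lintegral_valueAt_semiOneSidedG_le_one {Ω : Type*} [MeasurableSpace Ω] (X : ℕ → Ω → ℝ)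
    (hX : ∀ i, Measurable (X i)) {c : ℝ} (hc : 0 < c) {v : ℝ≥0} (hv : v ≠ 0) {Pr : Measure Ω}
    [IsProbabilityMeasure Pr] (hP : IsIID X (gaussianReal 0 v) Pr) {τ : Ω → WithTop ℕ+}
    (hτ : IsStoppingTime (scaleInvariantFiltration X hX) τ) :
    ∫⁻ ω, valueAt (fun (n : ℕ+) ω => semiOneSidedG c n (fun i => X i ω)) τ ω ∂Pr ≤ 1 := by
  exact lintegral_valueAt_le_one (𝒢 := scaleInvariantFiltration X hX)
    (E := fun (n : ℕ+) ω => mixtureLR c n (fun i => X i ω))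
    (measurable_mixtureLR_comp X hX c)
    (fun n _ hnm _ hA => setLIntegral_mixtureLR_eq_of_le hX c hv hP n.pos hnm hA)
    (fun n => lintegral_mixtureLR_le_one hX hc hv hP n n.pos)
    (fun n ω => ofReal_semiOneSidedG_le hc n.pos fun i => X i ω) hτ

theorem isEProcess_semiOneSidedG {Ω : Type*} [MeasurableSpace Ω] (X : ℕ → Ω → ℝ)
    (hX : ∀ i, Measurable (X i)) {c : ℝ} (hc : 0 < c) :
    IsEProcess X (normalsWithMean 0) (scaleInvariantFiltration X hX)
      (fun n ω => semiOneSidedG c n (fun i => X i ω)) where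
  nonneg n ω := semiOneSidedG_nonneg hc n _
  adapted n := measurable_semiOneSidedG_comp X hX c n
  expectation_le_one := by
    rintro P ⟨v, hv, rfl⟩ Pr hPr hP τ hτ
    exact lintegral_valueAt_semiOneSidedG_le_one X hX hc hv hP hτ

end Statistic

/-! ### Ville's inequality and the shape of the confidence sets -/

section ConfidenceSequence

/-- Ville's inequality for e-processes. -/
theorem IsEProcess.measure_exists_gt_le {Ω : Type*} [mΩ : MeasurableSpace Ω] {X : ℕ → Ω → ℝ}
    {Ps : Set (Measure ℝ)} {𝒢 : Filtration ℕ+ mΩ} {M : ℕ+ → Ω → ℝ} (hM : IsEProcess X Ps 𝒢 M)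
    {P : Measure ℝ} (hP : P ∈ Ps) {Pr : Measure Ω} [IsProbabilityMeasure Pr] (hX : IsIID X P Pr)
    {α : ℝ} (hα : 0 < α) :
    Pr {ω | ∃ n, 1 / α < M n ω} ≤ ENNReal.ofReal α := by
  classical
  set A := {ω | ∃ n, 1 / α < M n ω} with hA
  have hset : ∀ n, MeasurableSet[𝒢 n] {ω | 1 / α < M n ω} := fun n =>
    hM.adapted n measurableSet_Ioi
  have hAm : MeasurableSet A := by
    rw [hA, ofPred_exists]
    exact MeasurableSet.iUnion fun n => 𝒢.le _ _ (hset n)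
  -- First passage strictly above `1 / α`; Markov's inequality is then applied to the value at this
  -- time.
  let τ : Ω → WithTop ℕ+ := fun ω =>
    if h : ∃ n, 1 / α < M n ω then ((PNat.find h : ℕ+) : WithTop ℕ+) else ⊤
  have hτ : IsStoppingTime 𝒢 τ := by
    intro i
    have : {ω | τ ω ≤ i} = ⋃ n, ⋃ (_ : n ≤ i), {ω | 1 / α < M n ω} := by
      ext ω
      simp only [mem_ofPred_eq, mem_iUnion, exists_prop, τ]
      constructor
      · intro h
        split_ifs at h with hex
        · exact ⟨_, WithTop.coe_le_coe.1 h, PNat.find_spec hex⟩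
        · exact absurd h (not_le.2 (WithTop.coe_lt_top i))
      · rintro ⟨n, hn, h⟩
        have hex : ∃ n, 1 / α < M n ω := ⟨n, h⟩
        rw [dif_pos hex]
        exact WithTop.coe_le_coe.2 ((PNat.find_min' hex h).trans hn)
    rw [this]
    exact MeasurableSet.iUnion fun n => MeasurableSet.iUnion fun hn => 𝒢.mono hn _ (hset n)
  have hle := hM.expectation_le_one P hP Pr inferInstance hX τ hτ
  have hmark : ENNReal.ofReal (1 / α) * Pr A ≤ 1 := by
    rw [← lintegral_indicator_const hAm]
    refine (lintegral_mono fun ω => ?_).trans hle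
    by_cases hω : ω ∈ A
    · have hex : ∃ n, 1 / α < M n ω := hω
      have hv : valueAt M τ ω = ENNReal.ofReal (M (PNat.find hex) ω) := by
        simp only [valueAt, τ, dif_pos hex]
        rfl
      rw [indicator_of_mem hω, hv]
      exact ENNReal.ofReal_le_ofReal (PNat.find_spec hex).le
    · simp [indicator_of_notMem hω]
  rw [one_div, ENNReal.ofReal_inv_of_pos hα] at hmark
  have h0 : ENNReal.ofReal α ≠ 0 := by simpa using hα
  rwa [ENNReal.inv_mul_le_iff h0 ENNReal.ofReal_ne_top, mul_one] at hmark

lemma isIID_sub_const {Ω : Type*} [MeasurableSpace Ω] {X : ℕ → Ω → ℝ}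
    (hX : ∀ i, Measurable (X i)) {m : ℝ} {v : ℝ≥0} {Pr : Measure Ω}
    (h : IsIID X (gaussianReal m v) Pr) :
    IsIID (fun i ω => X i ω - m) (gaussianReal 0 v) Pr := by
  refine ⟨h.1.comp (fun _ x => x - m) fun _ => measurable_id.sub_const m, fun i => ?_⟩
  have := Measure.map_map (μ := Pr) (measurable_id.sub_const m) (hX i)
  rw [h.2 i] at this
  rw [← sub_self m, ← gaussianReal_map_sub_const m]
  exact this.symm

/-- Noncoverage at some time is the Ville event for the e-process of `X_i - μ`, taken on the scale
invariant filtration of those shifted data. -/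
theorem isConfidenceSequence_semiOneSidedCI {Ω : Type*} [MeasurableSpace Ω] (X : ℕ → Ω → ℝ)
    (hX : ∀ i, Measurable (X i)) {c : ℝ} (hc : 0 < c) {α : ℝ} (hα : 0 < α) :
    IsConfidenceSequence X normals (fun P => ∫ x, x ∂P) α (semiOneSidedCI X c α) := by
  rintro P ⟨m, v, hv, rfl⟩ Pr hPr hP
  have hY : ∀ i, Measurable fun ω => X i ω - m := fun i => (hX i).sub_const m
  have hE := isEProcess_semiOneSidedG _ hY hc
  have hville := hE.measure_exists_gt_le ⟨v, hv, rfl⟩ (isIID_sub_const hX hP) hα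
  have hset : {ω | ∀ n, ∫ x, x ∂(gaussianReal m v) ∈ semiOneSidedCI X c α n ω} =
      {ω | ∃ n : ℕ+, 1 / α < semiOneSidedG c n (fun i => X i ω - m)}ᶜ := by
    ext ω
    simp [semiOneSidedCI, integral_id_gaussianReal]
  have hm : MeasurableSet {ω | ∃ n : ℕ+, 1 / α < semiOneSidedG c n (fun i => X i ω - m)} := by
    rw [ofPred_exists]
    exact MeasurableSet.iUnion fun n => Filtration.le _ _ _ (hE.adapted n measurableSet_Ioi)
  rw [hset, prob_compl_eq_one_sub hm, ENNReal.ofReal_sub _ hα.le, ENNReal.ofReal_one]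
  gcongr

/-- The statistic of data with mean `d` and centered sum of squares `Q` is monotone in `d`. -/
lemma monotone_semiOneSidedStat {c : ℝ} (hc : 0 < c) {n : ℕ} (hn : 0 < n) {Q : ℝ} (hQ : 0 ≤ Q) :
    Monotone fun d : ℝ => semiOneSidedStat c n (n * d) (Q + n * d ^ 2) := by
  have hn' : (0 : ℝ) < n := by exact_mod_cast hn
  have hp : (0 : ℝ) < n + c ^ 2 := by positivity
  have hsv : ∀ d : ℝ, (n * d) ^ 2 ≤ n * (Q + n * d ^ 2) := fun d => by
    nlinarith [mul_nonneg hn'.le hQ]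
  intro d e hde
  dsimp only
  rcases le_or_gt d 0 with hd | hd
  · rw [semiOneSidedStat_of_nonpos c n (mul_nonpos_of_nonneg_of_nonpos hn'.le hd)]
    exact semiOneSidedStat_nonneg hc (by positivity) (hsv e)
  have he : 0 < e := hd.trans_le hde
  rw [semiOneSidedStat, semiOneSidedStat, min_eq_right (by positivity), min_eq_right (by positivity)]
  simp only [ne_eq, OfNat.ofNat_ne_zero, not_false_eq_true, zero_pow, zero_div, sub_zero,
    Real.one_rpow]
  refine mul_le_mul_of_nonneg_left (sub_le_sub_right ?_ 1) (by positivity)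
  refine Real.rpow_le_rpow_of_nonpos (one_sub_div_pos hc (by positivity) (hsv e)) ?_ (by linarith)
  refine sub_le_sub_left ?_ 1
  rw [div_le_div_iff₀ (by positivity) (by positivity)]
  -- After cross-multiplication, monotonicity of `S_n² / V_n` on `d > 0` comes down to this
  -- inequality.
  have h2 : d ^ 2 * Q ≤ e ^ 2 * Q := by gcongr
  have h3 := mul_le_mul_of_nonneg_left h2 (mul_pos (pow_pos hn' 2) hp).le
  nlinarith

lemma isClosed_semiOneSidedStat_le {c : ℝ} (hc : 0 < c) {n : ℕ} (hn : 0 < n) {Q : ℝ} (hQ : 0 ≤ Q)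
    {K : ℝ} (hK : 0 ≤ K) :
    IsClosed {d : ℝ | semiOneSidedStat c n (n * d) (Q + n * d ^ 2) ≤ K} := by
  have hn' : (0 : ℝ) < n := by exact_mod_cast hn
  have hp : (0 : ℝ) < n + c ^ 2 := by positivity
  have hneg : ∀ d : ℝ, d ≤ 0 → semiOneSidedStat c n (n * d) (Q + n * d ^ 2) ≤ K := fun d hd => by
    rwa [semiOneSidedStat_of_nonpos c n (mul_nonpos_of_nonneg_of_nonpos hn'.le hd)]
  -- When all observations coincide, `Q = 0` and the statistic may jump at `d = 0`: it is `0` for `d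
  -- ≤ 0` and constant for `d > 0`. The sublevel set is then the line or `Iic 0`. For `Q > 0` the
  -- statistic is continuous.
  rcases hQ.eq_or_lt with rfl | hQ
  · have hconst : ∀ d : ℝ, 0 < d → semiOneSidedStat c n (n * d) (0 + n * d ^ 2) =
        semiOneSidedStat c n (n * 1) (0 + n * 1 ^ 2) := fun d hd => by
      rw [semiOneSidedStat, semiOneSidedStat, min_eq_right (by positivity),
        min_eq_right (by positivity)]
      have : (n * d) ^ 2 / ((n + c ^ 2) * (0 + n * d ^ 2)) =
          ((n : ℝ) * 1) ^ 2 / ((n + c ^ 2) * (0 + n * 1 ^ 2)) := by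
        field_simp
        ring
      rw [this]
      simp
    by_cases h1 : semiOneSidedStat c n (n * 1) (0 + n * 1 ^ 2) ≤ K
    · convert isClosed_univ
      refine eq_univ_of_forall fun d => ?_
      rcases le_or_gt d 0 with hd | hd
      · exact hneg d hd
      · exact (hconst d hd).trans_le h1
    · convert isClosed_Iic (a := (0 : ℝ))
      ext d
      refine ⟨fun h => ?_, hneg d⟩
      by_contra hd
      exact h1 ((hconst d (not_le.1 hd)).symm.trans_le h)
  · have hv : ∀ d : ℝ, 0 < Q + n * d ^ 2 := fun d => by positivity
    have hsv : ∀ d : ℝ, (n * d) ^ 2 ≤ n * (Q + n * d ^ 2) := fun d => by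
      nlinarith [mul_pos hn' hQ]
    refine isClosed_le ?_ continuous_const
    unfold semiOneSidedStat
    refine continuous_const.mul (Continuous.sub ?_ ?_)
    · refine Continuous.rpow_const ?_ fun d => Or.inl (one_sub_div_pos hc (hv d) (hsv d)).ne'
      exact continuous_const.sub (Continuous.div (by fun_prop) (by fun_prop)
        fun d => (mul_pos hp (hv d)).ne')
    · refine Continuous.rpow_const ?_ fun d => Or.inl
        (one_sub_div_pos hc (hv d) ((sq_min_zero_le _).trans (hsv d))).ne'
      exact continuous_const.sub (Continuous.div (by fun_prop) (by fun_prop)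
        fun d => (mul_pos hp (hv d)).ne')

/-- The centered sum of squares is unaffected by shifts, so `m` enters only through `X̄_n - m`. -/
lemma semiOneSidedG_sub_const (c : ℝ) {n : ℕ} (hn : 0 < n) (x : ℕ → ℝ) (m : ℝ) :
    semiOneSidedG c n (fun i => x i - m) =
      semiOneSidedStat c n (n * (partialSum n x / n - m))
        (sumSq n x - partialSum n x ^ 2 / n + n * (partialSum n x / n - m) ^ 2) := by
  have hn' : (n : ℝ) ≠ 0 := by exact_mod_cast hn.ne'
  have hS : partialSum n (fun i => x i - m) = n * (partialSum n x / n - m) := by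
    rw [mul_sub, mul_div_cancel₀ _ hn']
    simp [partialSum]
  have hV : sumSq n (fun i => x i - m) =
      sumSq n x - partialSum n x ^ 2 / n + n * (partialSum n x / n - m) ^ 2 := by
    have : sumSq n (fun i => x i - m) = sumSq n x - 2 * partialSum n x * m + n * m ^ 2 := by
      simp only [sumSq, partialSum, sub_sq, Finset.sum_add_distrib, Finset.sum_sub_distrib,
        Finset.sum_const, Finset.card_range, nsmul_eq_mul, Finset.mul_sum, Finset.sum_mul]
    rw [this]
    field_simp
    ring
  rw [semiOneSidedG_eq, hS, hV]

/-- A nonempty closed upper set of reals is a ray with an endpoint in the extended reals. -/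
lemma exists_eq_setOf_coe_le {C : Set ℝ} (hC : IsClosed C) (hup : IsUpperSet C) {a : ℝ}
    (ha : a ∈ C) : ∃ L : EReal, L ≤ (a : EReal) ∧ C = {m : ℝ | L ≤ (m : EReal)} := by
  by_cases hb : BddBelow C
  · refine ⟨(sInf C : ℝ), EReal.coe_le_coe_iff.2 (csInf_le hb ha), ?_⟩
    ext m
    simp only [mem_ofPred_eq, EReal.coe_le_coe_iff]
    exact ⟨fun h => csInf_le hb h, fun h => hup h (hC.csInf_mem ⟨a, ha⟩ hb)⟩
  · refine ⟨⊥, bot_le, ?_⟩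
    ext m
    simp only [mem_ofPred_eq, bot_le, iff_true]
    obtain ⟨b, hbC, hbm⟩ := not_bddBelow_iff.1 hb m
    exact hup hbm.le hbC

theorem exists_semiOneSidedCI_eq {Ω : Type*} (X : ℕ → Ω → ℝ) {c : ℝ} (hc : 0 < c) {α : ℝ}
    (hα : 0 < α) (n : ℕ+) (ω : Ω) : ∃ L : EReal,
      L ≤ ((partialSum n (fun i => X i ω) / n : ℝ) : EReal) ∧
      semiOneSidedCI X c α n ω = {m : ℝ | L ≤ (m : EReal)} := by
  set x : ℕ → ℝ := fun i => X i ω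
  have hn' : (0 : ℝ) < n := by exact_mod_cast n.pos
  have hQ : 0 ≤ sumSq n x - partialSum n x ^ 2 / n := by
    rw [sub_nonneg, div_le_iff₀ hn', mul_comm]
    exact sq_partialSum_le n x
  have hK : (0 : ℝ) ≤ 1 / α := by positivity
  have hset : semiOneSidedCI X c α n ω = (fun m => partialSum n x / n - m) ⁻¹'
      {d : ℝ | semiOneSidedStat c n (n * d) (sumSq n x - partialSum n x ^ 2 / n + n * d ^ 2)
        ≤ 1 / α} := by
    ext m
    simp only [semiOneSidedCI, mem_ofPred_eq, mem_preimage,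
      semiOneSidedG_sub_const c n.pos (fun i => X i ω) m, x]
  rw [hset]
  refine exists_eq_setOf_coe_le ?_ ?_ ?_
  · exact (isClosed_semiOneSidedStat_le hc n.pos hQ hK).preimage (by fun_prop)
  · intro m m' hmm' hm
    exact (monotone_semiOneSidedStat hc n.pos hQ (sub_le_sub_left hmm' _)).trans hm
  -- The point `X̄_n` belongs to the set: there `d = 0` and the statistic vanishes.
  · simpa [semiOneSidedStat] using hα.le

end ConfidenceSequence

end TTest

theorem mainTheorem9 {Ω : Type*} [MeasurableSpace Ω] (X : ℕ → Ω → ℝ)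
    (hX : ∀ i, Measurable (X i)) (c : ℝ) (hc : 0 < c) :
    (∀ (n : ℕ+) (x : ℕ → ℝ),
      TTest.semiOneSidedG c n x =
        2 * TTest.twoSidedG c n (TTest.partialSum n x) (TTest.sumSq n x)
          - 2 * TTest.twoSidedG c n (min (TTest.partialSum n x) 0) (TTest.sumSq n x)) ∧
    TTest.IsEProcess X (TTest.normalsWithMean 0) (TTest.scaleInvariantFiltration X hX)
      (fun n ω => TTest.semiOneSidedG c n (fun i => X i ω)) ∧
    (∀ (n : ℕ+) (x : ℕ → ℝ), TTest.sumSq n x ≠ 0 →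
      Integrable (fun θ => TTest.scaleInvariantLR θ 0 n x) (TTest.halfGaussian c) ∧
      TTest.semiOneSidedG c n x ≤
        2 * ∫ θ, TTest.scaleInvariantLR θ 0 n x ∂(TTest.halfGaussian c)) ∧
    (∀ α : ℝ, 0 < α → α < 1 →
      TTest.IsConfidenceSequence X TTest.normals (fun P => ∫ x, x ∂P) α
        (TTest.semiOneSidedCI X c α) ∧
      ∀ (n : ℕ+) (ω : Ω), ∃ L : EReal,
        L ≤ ((TTest.partialSum n (fun i => X i ω) / n : ℝ) : EReal) ∧
        TTest.semiOneSidedCI X c α n ω = {m : ℝ | L ≤ (m : EReal)}) := by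
  exact ⟨fun n x => TTest.semiOneSidedG_eq_twoSidedG hc n x,
    TTest.isEProcess_semiOneSidedG X hX hc,
    fun n x hx => TTest.semiOneSidedG_le_integral hc n.pos hx,
    fun α hα _ => ⟨TTest.isConfidenceSequence_semiOneSidedCI X hX hc hα,
      TTest.exists_semiOneSidedCI_eq X hc hα⟩⟩
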